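/- Let $G^D$ be the group of bijections $g:\mathbb Z\to\mathbb Z$ moving only finitely many points with $g(0)=0$ and $g(\mathbb N)=\mathbb N$ (where $\mathbb N=\{1,2,\dots\}$), and let $G^E\supset G^D$ be the group of all such finite bijections with $g(0)=0$. For $G=G^D$ or $G^E$ let $K=\{g\in G: g(-i)=-g(i)\ \forall i\}$, $K_n=\{g\in K: g(i)=i \text{ for } |i|\le n\}$ and $G(n)=\{g\in G: g(i)=i\text{ for }|i|>n\}$. A unitary representation $\pi$ of $G$ in a complex Hilbert space $H(\pi)$ is an admissible representation of the pair $(G,K)$ if $\bigcup_n H(\pi)_n$ is dense in $H(\pi)$, where $H(\pi)_n$ is the space of $K_n$-invariant vectors. If $\pi$ is irreducible and admissible, its depth $d$ is the least $n$ with $H(\pi)_n\neq0$, and $R(\pi)=H(\pi)_d$ is its root. For $i\neq0$ the operator $A_i$ on $H(\pi)$ is the weak limit of the operators $\pi((i,n))$ over the transpositions $(i,n)\in G$ as $|n|\to\infty$; the limit exists for admissible $\pi$. A Young distribution $\Lambda$ is a function from $[-1,1]$ to Young diagrams with $\Lambda(x)=\emptyset$ for all but finitely many $x$; $|\Lambda|=\sum_x|\Lambda(x)|$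 and $\operatorname{supp}\Lambda=\{x:\Lambda(x)\ne\emptyset\}$. Let $\Sigma(m)=S(m)\ltimes\mathbb Z_{\ge0}^m$, with generators $g\in S(m)$ and $A_1,\dots,A_m$, where $gA_jg^{-1}=A_{g(j)}$. For $|\Lambda|=m$ let $V_\Lambda$ be the $\Sigma(m)$-module induced from the $\prod_{x\in\operatorname{supp}\Lambda}\Sigma(|\Lambda(x)|)$-module $\bigotimes_{x\in\operatorname{supp}\Lambda} V_{\Lambda(x),x}$, where on $V_{\lambda,x}$ the symmetric group acts by its irreducible representation corresponding to $\lambda$ and every $A_j$ acts as multiplication by $x$. (i) Let $\pi$ be an irreducible admissible representation of $(G^D,K^D)$ of depth $d>0$ corresponding to Young distributions $\Lambda,\mathrm M$; that is, $R(\pi)\cong V_\Lambda\otimes V_{\mathrm M}$, where $V_\Lambda$ describes the action of the permutations of $\{1,\dots,d\}$ and of $A_1,\dots,A_d$, and $V_{\mathrm M}$ describes the action of the permutations of $\{-1,\dots,-d\}$ and of $A_{-1},\dots,A_{-d}$. Let $\mu$ be the spectral measure of the self-adjoint operator $A_{d+1}$ with respect to any unit vector $\zeta\in R(\pi)$, and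 let $\operatorname{supp}\mu$ denote the set of its atoms. Then $$\operatorname{supp}\Lambda\subset\operatorname{supp}\mu\cup\{0\},\qquad \operatorname{supp}\mathrm M\subset\operatorname{supp}\mu\cup\{0\}.$$ (ii) Let $\pi$ be an irreducible admissible representation of $(G^E,K^E)$ of depth $d\ge 0$ corresponding to the Young distribution $\Lambda$; that is, $R(\pi)\cong V_\Lambda$ as a module over $G^E(d)$ (the permutations of $\{\pm1,\dots,\pm d\}$) and the operators $A_i$, $1\le|i|\le d$. Let $\mu$ be the spectral measure of $A_{d+1}$ with respect to any unit vector of $R(\pi)$, and $\operatorname{supp}\mu$ the set of its atoms. Then $\operatorname{supp}\Lambda\subset\operatorname{supp}\mu\cup\{0\}$. -/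

import Mathlib

open scoped TensorProduct InnerProductSpace MonoidAlgebra

noncomputable section

namespace Olshanski

/-! ### The groups -/

/-- The group of all finite bijections of `ℤ`. -/
def GO : Subgroup (Equiv.Perm ℤ) where
  carrier := {g | {i : ℤ | g i ≠ i}.Finite}
  one_mem' := by simp
  mul_mem' := by
    intro a b ha hb
    refine (Set.Finite.union ha hb).subset ?_
    intro i hi
    by_contra h
    simp only [Set.mem_union, Set.mem_ofPred_eq, not_or, not_not] at h
    exact hi (by rw [Equiv.Perm.mul_apply, h.2, h.1])
  inv_mem' := by
    intro a ha
    refine Set.Finite.subset ha ?_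
    intro i hi h
    exact hi (by rw [Equiv.Perm.inv_eq_iff_eq]; exact h.symm)

/-- The group `G^E`: the finite bijections of `ℤ` which fix `0`. -/
def GE : Subgroup (Equiv.Perm ℤ) where
  carrier := {g | g ∈ GO ∧ g 0 = 0}
  one_mem' := ⟨GO.one_mem, rfl⟩
  mul_mem' := by
    rintro a b ⟨ha, ha0⟩ ⟨hb, hb0⟩
    exact ⟨GO.mul_mem ha hb, by rw [Equiv.Perm.mul_apply, hb0, ha0]⟩
  inv_mem' := by
    rintro a ⟨ha, ha0⟩
    exact ⟨GO.inv_mem ha, by rw [Equiv.Perm.inv_eq_iff_eq, ha0]⟩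

/-- The group `G^D`: the finite bijections of `ℤ` which fix `0` and map the set of positive
integers onto itself. -/
def GD : Subgroup (Equiv.Perm ℤ) where
  carrier := {g | g ∈ GO ∧ g 0 = 0 ∧ g '' {i : ℤ | 0 < i} = {i : ℤ | 0 < i}}
  one_mem' := ⟨GO.one_mem, rfl, by simp⟩
  mul_mem' := by
    rintro a b ⟨ha, ha0, ha1⟩ ⟨hb, hb0, hb1⟩
    refine ⟨GO.mul_mem ha hb, by rw [Equiv.Perm.mul_apply, hb0, ha0], ?_⟩
    rw [Equiv.Perm.coe_mul, Set.image_comp, hb1, ha1]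
  inv_mem' := by
    rintro a ⟨ha, ha0, ha1⟩
    refine ⟨GO.inv_mem ha, by rw [Equiv.Perm.inv_eq_iff_eq, ha0], ?_⟩
    conv_lhs => rw [← ha1]
    rw [← Set.image_comp, ← Equiv.Perm.coe_mul, inv_mul_cancel]
    simp

/-- The subgroup `K = {g ∈ G | g(-i) = -g(i)}` of `G`. -/
def K (G : Subgroup (Equiv.Perm ℤ)) : Subgroup G where
  carrier := {g | ∀ i : ℤ, (g : Equiv.Perm ℤ) (-i) = -(g : Equiv.Perm ℤ) i}
  one_mem' := by simp
  mul_mem' := by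
    intro a b ha hb i
    simp only [Subgroup.coe_mul, Equiv.Perm.mul_apply]
    rw [hb, ha]
  inv_mem' := by
    intro a ha i
    simp only [Subgroup.coe_inv]
    rw [Equiv.Perm.inv_eq_iff_eq, ha, ← Equiv.Perm.mul_apply, mul_inv_cancel, Equiv.Perm.one_apply]

/-- The subgroup `G(n) = {g ∈ G | g(i) = i for |i| > n}` of `G`. -/
def finiteLevel (G : Subgroup (Equiv.Perm ℤ)) (n : ℕ) : Subgroup G where
  carrier := {g | ∀ i : ℤ, (n : ℤ) < |i| → (g : Equiv.Perm ℤ) i = i}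
  one_mem' := by simp
  mul_mem' := by
    intro a b ha hb i hi
    simp only [Subgroup.coe_mul, Equiv.Perm.mul_apply]
    rw [hb i hi, ha i hi]
  inv_mem' := by
    intro a ha i hi
    simp only [Subgroup.coe_inv]
    rw [Equiv.Perm.inv_eq_iff_eq, ha i hi]

/-- The subgroup `G_n = {g ∈ G | g(i) = i for |i| ≤ n}` of `G`. -/
def tailLevel (G : Subgroup (Equiv.Perm ℤ)) (n : ℕ) : Subgroup G where
  carrier := {g | ∀ i : ℤ, |i| ≤ (n : ℤ) → (g : Equiv.Perm ℤ) i = i}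
  one_mem' := by simp
  mul_mem' := by
    intro a b ha hb i hi
    simp only [Subgroup.coe_mul, Equiv.Perm.mul_apply]
    rw [hb i hi, ha i hi]
  inv_mem' := by
    intro a ha i hi
    simp only [Subgroup.coe_inv]
    rw [Equiv.Perm.inv_eq_iff_eq, ha i hi]

/-- The subgroup `K_n = K ∩ G_n`. -/
def tailK (G : Subgroup (Equiv.Perm ℤ)) (n : ℕ) : Subgroup G := K G ⊓ tailLevel G n

/-! ### Unitary representations, admissibility, depth -/

section Representations

variable {G : Subgroup (Equiv.Perm ℤ)} {H : Type*} [NormedAddCommGroup H]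
  [InnerProductSpace ℂ H] [CompleteSpace H]

/-- The operator `π(g)`. -/
def op (π : G →* unitary (H →L[ℂ] H)) (g : G) : H →L[ℂ] H := (π g : H →L[ℂ] H)

/-- The subspace `H(π)_n` of `K_n`-invariant vectors. -/
def invariants (π : G →* unitary (H →L[ℂ] H)) (n : ℕ) : Submodule ℂ H where
  carrier := {ζ | ∀ k ∈ tailK G n, op π k ζ = ζ}
  add_mem' := by
    intro a b ha hb k hk
    rw [map_add, ha k hk, hb k hk]
  zero_mem' := by
    intro k _
    exact map_zero _
  smul_mem' := by
    intro c a ha k hk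
    rw [map_smul, ha k hk]

/-- A unitary representation of `G` is an admissible representation of the pair `(G, K)` if the
union of the subspaces `H(π)_n` is dense. -/
def IsAdmissible (π : G →* unitary (H →L[ℂ] H)) : Prop :=
  closure (⋃ n : ℕ, (invariants π n : Set H)) = Set.univ

/-- Topological irreducibility of a unitary representation. -/
def IsIrreducible (π : G →* unitary (H →L[ℂ] H)) : Prop :=
  Nontrivial H ∧ ∀ W : Submodule ℂ H, IsClosed (W : Set H) →
    (∀ g : G, ∀ ζ ∈ W, op π g ζ ∈ W) → W = ⊥ ∨ W = ⊤

/-- The representation `π` has depth `d`: `d` is the least `k` with `H(π)_k ≠ 0`. -/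
def HasDepth (π : G →* unitary (H →L[ℂ] H)) (d : ℕ) : Prop :=
  IsLeast {k : ℕ | invariants π k ≠ ⊥} d

/-! ### The operators `A_i` -/

/-- `A` is the limit, in the weak operator topology, of the operators of the transpositions
`(i, n) ∈ G` as `|n| → ∞`. -/
def IsTranspositionLimit (π : G →* unitary (H →L[ℂ] H)) (i : ℤ) (A : H →L[ℂ] H) : Prop :=
  ∀ ζ η : H, Filter.Tendsto
    (fun n : {n : ℤ // Equiv.swap i n ∈ G} => ⟪η, op π ⟨Equiv.swap i n, n.2⟩ ζ⟫_ℂ)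
    Filter.cofinite (nhds ⟪η, A ζ⟫_ℂ)

open Classical in
/-- The operator `π(A_i)`, the weak limit of the transpositions `(i, n) ∈ G` as `|n| → ∞`. The
limit exists for `i ≠ 0` in every admissible representation of the pairs `(G^D, K^D)` and
`(G^E, K^E)`, see `isTranspositionLimit_opA_GD` and `isTranspositionLimit_opA_GE`. -/
def opA (π : G →* unitary (H →L[ℂ] H)) (i : ℤ) : H →L[ℂ] H :=
  if h : ∃ A : H →L[ℂ] H, IsTranspositionLimit π i A then h.choose else 0


theorem norm_op_apply (π : G →* unitary (H →L[ℂ] H)) (g : G) (ζ : H) : ‖op π g ζ‖ = ‖ζ‖ :=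
  ContinuousLinearMap.norm_map_of_mem_unitary (π g).2 ζ

theorem inner_op_op (π : G →* unitary (H →L[ℂ] H)) (g : G) (ζ η : H) :
    ⟪op π g ζ, op π g η⟫_ℂ = ⟪ζ, η⟫_ℂ :=
  ContinuousLinearMap.inner_map_map_of_mem_unitary (π g).2 ζ η

theorem op_mul (π : G →* unitary (H →L[ℂ] H)) (g h : G) (ζ : H) :
    op π (g * h) ζ = op π g (op π h ζ) := by
  simp [op]

theorem invariants_mono (π : G →* unitary (H →L[ℂ] H)) {m n : ℕ} (h : m ≤ n) :
    invariants π m ≤ invariants π n := by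
  intro ζ hζ k hk
  exact hζ k ⟨hk.1, fun i hi => hk.2 i (hi.trans (by exact_mod_cast h))⟩

/-- A bounded family of operators which converges weakly on a dense set converges weakly. -/
theorem exists_weak_limit {ι : Type*} (l : Filter ι) (F : ι → H →L[ℂ] H)
    (hF : ∀ n ζ, ‖F n ζ‖ ≤ ‖ζ‖) (S : Set H) (hS : Dense S)
    (h : ∀ ζ ∈ S, ∀ η ∈ S, ∃ c, Filter.Tendsto (fun n => ⟪η, F n ζ⟫_ℂ) l (nhds c)) :
    ∃ A : H →L[ℂ] H, ∀ ζ η, Filter.Tendsto (fun n => ⟪η, F n ζ⟫_ℂ) l (nhds ⟪η, A ζ⟫_ℂ) := by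
  rcases l.eq_or_neBot with rfl | hl
  · exact ⟨0, fun _ _ => Filter.tendsto_bot⟩
  have hest : ∀ n (ζ η : H), ‖⟪F n ζ, η⟫_ℂ‖ ≤ ‖ζ‖ * ‖η‖ := fun n ζ η =>
    (norm_inner_le_norm _ _).trans (mul_le_mul_of_nonneg_right (hF n ζ) (norm_nonneg _))
  have hall : ∀ ζ η : H, ∃ c, Filter.Tendsto (fun n => ⟪F n ζ, η⟫_ℂ) l (nhds c) := by
    intro ζ η
    refine cauchy_map_iff_exists_tendsto.1 (Metric.cauchy_iff.2 ⟨inferInstance, fun ε hε => ?_⟩)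
    obtain ⟨ζ', hζ', h1⟩ := Metric.dense_iff.1 hS ζ (ε / (8 * (‖η‖ + 1))) (by positivity)
    obtain ⟨η', hη', h2⟩ := Metric.dense_iff.1 hS η (ε / (8 * (‖ζ'‖ + 1))) (by positivity)
    obtain ⟨c, hc⟩ := h ζ' h1 η' h2
    have hc' : Filter.Tendsto (fun n => ⟪F n ζ', η'⟫_ℂ) l (nhds ((starRingEnd ℂ) c)) := by
      have := (Complex.continuous_conj.tendsto c).comp hc
      refine this.congr fun n => ?_
      simp only [Function.comp_apply]
      rw [inner_conj_symm]
    obtain ⟨t, ht, ht'⟩ := (Metric.cauchy_iff.1 (hc'.cauchy_map)).2 (ε / 4) (by positivity)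
    have hclose : ∀ n, ‖⟪F n ζ, η⟫_ℂ - ⟪F n ζ', η'⟫_ℂ‖ ≤ ε / 8 + ε / 8 := by
      intro n
      have e : ⟪F n ζ, η⟫_ℂ - ⟪F n ζ', η'⟫_ℂ = ⟪F n (ζ - ζ'), η⟫_ℂ + ⟪F n ζ', η - η'⟫_ℂ := by
        rw [map_sub, inner_sub_left, inner_sub_right]; ring
      rw [e]
      refine (norm_add_le _ _).trans (add_le_add ((hest _ _ _).trans ?_) ((hest _ _ _).trans ?_))
      · have : ‖ζ - ζ'‖ ≤ ε / (8 * (‖η‖ + 1)) := by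
          rw [← dist_eq_norm, dist_comm]; exact (Metric.mem_ball.1 hζ').le
        calc ‖ζ - ζ'‖ * ‖η‖ ≤ ε / (8 * (‖η‖ + 1)) * (‖η‖ + 1) :=
              mul_le_mul this (by linarith) (norm_nonneg _) (by positivity)
          _ = ε / 8 := by field_simp
      · have : ‖η - η'‖ ≤ ε / (8 * (‖ζ'‖ + 1)) := by
          rw [← dist_eq_norm, dist_comm]; exact (Metric.mem_ball.1 hη').le
        calc ‖ζ'‖ * ‖η - η'‖ ≤ (‖ζ'‖ + 1) * (ε / (8 * (‖ζ'‖ + 1))) :=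
              mul_le_mul (by linarith) this (norm_nonneg _) (by positivity)
          _ = ε / 8 := by field_simp
    refine ⟨_, Filter.image_mem_map (Filter.mem_map.1 ht), ?_⟩
    rintro _ ⟨n, hn, rfl⟩ _ ⟨p, hp, rfl⟩
    have h3 := ht' _ hn _ hp
    rw [dist_eq_norm] at h3 ⊢
    have e : ⟪F n ζ, η⟫_ℂ - ⟪F p ζ, η⟫_ℂ = (⟪F n ζ, η⟫_ℂ - ⟪F n ζ', η'⟫_ℂ)
        + (⟪F n ζ', η'⟫_ℂ - ⟪F p ζ', η'⟫_ℂ) - (⟪F p ζ, η⟫_ℂ - ⟪F p ζ', η'⟫_ℂ) := by ring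
    have h4 := norm_sub_le ((⟪F n ζ, η⟫_ℂ - ⟪F n ζ', η'⟫_ℂ)
        + (⟪F n ζ', η'⟫_ℂ - ⟪F p ζ', η'⟫_ℂ)) (⟪F p ζ, η⟫_ℂ - ⟪F p ζ', η'⟫_ℂ)
    have h5 := norm_add_le (⟪F n ζ, η⟫_ℂ - ⟪F n ζ', η'⟫_ℂ) (⟪F n ζ', η'⟫_ℂ - ⟪F p ζ', η'⟫_ℂ)
    rw [e]
    have h6 := hclose n
    have h7 := hclose p
    linarith
  choose B hB using hall
  have hBn : ∀ ζ η, ‖B ζ η‖ ≤ 1 * ‖ζ‖ * ‖η‖ := fun ζ η =>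
    le_of_tendsto (hB ζ η).norm (Filter.Eventually.of_forall fun n => by
      rw [one_mul]; exact hest n ζ η)
  let L : H →ₗ⋆[ℂ] H →ₗ[ℂ] ℂ := LinearMap.mk₂'ₛₗ (starRingEnd ℂ) (RingHom.id ℂ) B
    (fun a b η => tendsto_nhds_unique (hB _ _) (((hB a η).add (hB b η)).congr fun n => by
      rw [map_add, inner_add_left]))
    (fun c a η => tendsto_nhds_unique (hB _ _)
      (((hB a η).const_mul ((starRingEnd ℂ) c)).congr fun n => by
        rw [map_smul, inner_smul_left]))
    (fun ζ a b => tendsto_nhds_unique (hB _ _) (((hB ζ a).add (hB ζ b)).congr fun n => by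
      rw [inner_add_right]))
    (fun c ζ a => tendsto_nhds_unique (hB _ _) (((hB ζ a).const_mul c).congr fun n => by
      rw [inner_smul_right]))
  refine ⟨InnerProductSpace.continuousLinearMapOfBilin (L.mkContinuous₂ 1 hBn), fun ζ η => ?_⟩
  have e : ⟪η, InnerProductSpace.continuousLinearMapOfBilin (L.mkContinuous₂ 1 hBn) ζ⟫_ℂ
      = (starRingEnd ℂ) (B ζ η) := by
    rw [← inner_conj_symm, InnerProductSpace.continuousLinearMapOfBilin_apply]
    rfl
  rw [e]
  refine ((Complex.continuous_conj.tendsto (B ζ η)).comp (hB ζ η)).congr fun n => ?_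
  simp only [Function.comp_apply]
  rw [inner_conj_symm]

/-- The conjugation argument: in `G`, the transpositions `(i, a)` and `(i, b)` are conjugate under
`K_m` as soon as `|i| ≤ m < |a|, |b|`. -/
theorem exists_conj (hG : ∀ g ∈ G, Equiv.neg ℤ * g * Equiv.neg ℤ ∈ G) {m : ℕ} {i a b : ℤ}
    (hi : |i| ≤ m) (ha : (m : ℤ) < |a|) (hb : (m : ℤ) < |b|) (hia : Equiv.swap i a ∈ G)
    (hib : Equiv.swap i b ∈ G) :
    ∃ k ∈ tailK G m, k * ⟨Equiv.swap i a, hia⟩ * k⁻¹ = (⟨Equiv.swap i b, hib⟩ : G) := by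
  suffices h : ∃ k ∈ G, (∀ j : ℤ, k (-j) = -k j) ∧ (∀ j : ℤ, |j| ≤ m → k j = j) ∧ k a = b by
    obtain ⟨k, hk, h1, h2, h3⟩ := h
    refine ⟨⟨k, hk⟩, ⟨h1, h2⟩, Subtype.ext ?_⟩
    change k * Equiv.swap i a * k⁻¹ = Equiv.swap i b
    rw [← Equiv.swap_apply_apply, h2 i hi, h3]
  rw [abs_le] at hi
  rw [lt_abs] at ha hb
  by_cases hab : a = b
  · exact ⟨1, G.one_mem, fun _ => rfl, fun _ _ => rfl, hab⟩
  have hs : Equiv.swap a b ∈ G := by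
    have h := G.mul_mem (G.mul_mem hia hib) (G.inv_mem hia)
    rw [← Equiv.swap_apply_apply, Equiv.swap_apply_left,
      Equiv.swap_apply_of_ne_of_ne (by omega) (by omega)] at h
    exact h
  by_cases hn : b = -a
  · refine ⟨Equiv.swap a b, hs, fun j => ?_, fun j hj => ?_, Equiv.swap_apply_left a b⟩
    · simp only [Equiv.swap_apply_def]
      split_ifs <;> omega
    · rw [abs_le] at hj
      exact Equiv.swap_apply_of_ne_of_ne (by omega) (by omega)
  have hs' : Equiv.swap (-a) (-b) ∈ G := by
    have h := hG _ hs
    have e : Equiv.neg ℤ * Equiv.swap a b * Equiv.neg ℤ = Equiv.swap (-a) (-b) := by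
      have := Equiv.swap_apply_apply (Equiv.neg ℤ) a b
      exact this.symm
    rwa [e] at h
  refine ⟨Equiv.swap a b * Equiv.swap (-a) (-b), G.mul_mem hs hs', fun j => ?_, fun j hj => ?_, ?_⟩
  · simp only [Equiv.Perm.mul_apply, Equiv.swap_apply_def]
    split_ifs <;> omega
  · rw [abs_le] at hj
    rw [Equiv.Perm.mul_apply, Equiv.swap_apply_of_ne_of_ne (x := j) (by omega) (by omega),
      Equiv.swap_apply_of_ne_of_ne (by omega) (by omega)]
  · rw [Equiv.Perm.mul_apply, Equiv.swap_apply_of_ne_of_ne (x := a) (by omega) (by omega),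
      Equiv.swap_apply_left]

theorem isTranspositionLimit_opA (hG : ∀ g ∈ G, Equiv.neg ℤ * g * Equiv.neg ℤ ∈ G)
    (π : G →* unitary (H →L[ℂ] H)) (hπ : IsAdmissible π) (i : ℤ) :
    IsTranspositionLimit π i (opA π i) := by
  have hex : ∃ A : H →L[ℂ] H, IsTranspositionLimit π i A := by
    refine exists_weak_limit _
      (fun n : {n : ℤ // Equiv.swap i n ∈ G} => op π ⟨Equiv.swap i n, n.2⟩)
      (fun n ζ => (norm_op_apply π _ ζ).le) _ (dense_iff_closure_eq.2 hπ) ?_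
    intro ζ hζ η hη
    obtain ⟨m₁, hm₁⟩ := Set.mem_iUnion.1 hζ
    obtain ⟨m₂, hm₂⟩ := Set.mem_iUnion.1 hη
    set m : ℕ := max (max m₁ m₂) i.natAbs with hm
    have hζm : ζ ∈ invariants π m := invariants_mono π (by omega) hm₁
    have hηm : η ∈ invariants π m := invariants_mono π (by omega) hm₂
    have him : |i| ≤ m := by
      rw [Int.abs_eq_natAbs]
      omega
    have hfin : ∀ᶠ n : {n : ℤ // Equiv.swap i n ∈ G} in Filter.cofinite, (m : ℤ) < |n.1| := by
      have h1 : {n : ℤ | ¬ (m : ℤ) < |n|}.Finite :=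
        (Set.finite_Icc (-m : ℤ) m).subset fun n hn => by
          have : ¬ (m : ℤ) < |n| := hn
          rw [not_lt, abs_le] at this
          exact this
      exact Filter.eventually_cofinite.2 (h1.preimage Subtype.val_injective.injOn)
    by_cases hne : ∃ n : {n : ℤ // Equiv.swap i n ∈ G}, (m : ℤ) < |n.1|
    · obtain ⟨n₀, hn₀⟩ := hne
      refine ⟨⟪η, op π ⟨Equiv.swap i n₀, n₀.2⟩ ζ⟫_ℂ, tendsto_const_nhds.congr' ?_⟩
      filter_upwards [hfin] with n hn
      obtain ⟨k, hk, hk'⟩ := exists_conj hG him hn₀ hn n₀.2 n.2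
      rw [← hk', op_mul, op_mul, hζm _ (inv_mem hk)]
      conv_rhs => rw [← hηm k hk]
      rw [inner_op_op]
    · refine ⟨0, Filter.Tendsto.congr' ?_ tendsto_const_nhds⟩
      filter_upwards [hfin] with n hn
      exact absurd ⟨n, hn⟩ hne
  rw [opA, dif_pos hex]
  exact hex.choose_spec

theorem neg_conj_mem_GO : ∀ g ∈ GO, Equiv.neg ℤ * g * Equiv.neg ℤ ∈ GO := by
  intro g hg
  refine (Set.Finite.preimage (f := fun i : ℤ => -i) neg_injective.injOn hg).subset ?_
  intro i hi h
  exact hi (by simp [Equiv.Perm.mul_apply, show g (-i) = -i from h])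

theorem neg_conj_mem_GE : ∀ g ∈ GE, Equiv.neg ℤ * g * Equiv.neg ℤ ∈ GE := by
  rintro g ⟨hg, hg0⟩
  exact ⟨neg_conj_mem_GO g hg, by simp [Equiv.Perm.mul_apply, hg0]⟩

theorem neg_conj_mem_GD : ∀ g ∈ GD, Equiv.neg ℤ * g * Equiv.neg ℤ ∈ GD := by
  rintro g ⟨hg, hg0, hg1⟩
  refine ⟨neg_conj_mem_GO g hg, by simp [Equiv.Perm.mul_apply, hg0], ?_⟩
  have h : ∀ j : ℤ, 0 < g j ↔ 0 < j := by
    intro j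
    have : g j ∈ g '' {i : ℤ | 0 < i} ↔ j ∈ {i : ℤ | 0 < i} := g.injective.mem_set_image
    rw [hg1] at this
    exact this
  have h0 : ∀ j : ℤ, g j = 0 ↔ j = 0 := fun j => by
    conv_lhs => rw [← hg0]
    exact g.injective.eq_iff
  ext j
  obtain ⟨l, rfl⟩ := (Equiv.neg ℤ * g * Equiv.neg ℤ).surjective j
  rw [(Equiv.neg ℤ * g * Equiv.neg ℤ).injective.mem_set_image]
  have h1 := h (-l)
  have h2 := h0 (-l)
  simp only [Set.mem_ofPred_eq, Equiv.Perm.mul_apply, Equiv.neg_apply]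
  omega

/-- In an admissible representation of `(G^D, K^D)`, the operator `π(A_i)` is the weak limit of
the transpositions `(i, n) ∈ G^D`. -/
theorem isTranspositionLimit_opA_GD (π : GD →* unitary (H →L[ℂ] H)) (hπ : IsAdmissible π)
    (i : ℤ) : IsTranspositionLimit π i (opA π i) :=
  isTranspositionLimit_opA neg_conj_mem_GD π hπ i

/-- In an admissible representation of `(G^E, K^E)`, the operator `π(A_i)` is the weak limit of
the transpositions `(i, n) ∈ G^E`. -/
theorem isTranspositionLimit_opA_GE (π : GE →* unitary (H →L[ℂ] H)) (hπ : IsAdmissible π)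
    (i : ℤ) : IsTranspositionLimit π i (opA π i) :=
  isTranspositionLimit_opA neg_conj_mem_GE π hπ i

end Representations

/-! ### Spectral measures -/

section Spectral

variable {H : Type*} [NormedAddCommGroup H] [InnerProductSpace ℂ H] [CompleteSpace H]

/-- The positive functional `f ↦ (f(A) ζ, ζ)` on compactly supported continuous functions, for
the continuous functional calculus of a self-adjoint operator `A`. -/
def spectralFunctional (A : H →L[ℂ] H) (ζ : H) : CompactlySupportedContinuousMap ℝ ℝ →ₚ[ℝ] ℝ :=
  PositiveLinearMap.mk₀
    { toFun := fun f => (⟪ζ, (cfc (fun t : ℝ => f t) A : H →L[ℂ] H) ζ⟫_ℂ).re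
      map_add' := by
        intro f g
        have hf : ContinuousOn (fun t : ℝ => f t) (spectrum ℝ A) := f.continuous.continuousOn
        have hg : ContinuousOn (fun t : ℝ => g t) (spectrum ℝ A) := g.continuous.continuousOn
        have h := cfc_add (a := A) (fun t : ℝ => f t) (fun t : ℝ => g t) hf hg
        simp only [CompactlySupportedContinuousMap.add_apply]
        rw [h, add_apply, inner_add_right, Complex.add_re]
      map_smul' := by
        intro c f
        have hf : ContinuousOn (fun t : ℝ => f t) (spectrum ℝ A) := f.continuous.continuousOn
        have h := cfc_smul c (fun t : ℝ => f t) A hf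
        simp only [CompactlySupportedContinuousMap.smul_apply]
        rw [h, smul_apply, inner_smul_right_eq_smul, Complex.real_smul,
          Complex.re_ofReal_mul]
        rfl }
    (by
      intro f hf
      have h : (0 : H →L[ℂ] H) ≤ cfc (fun t : ℝ => f t) A := cfc_nonneg fun t _ => hf t
      exact ((ContinuousLinearMap.nonneg_iff_isPositive _).1 h).re_inner_nonneg_right ζ)

/-- The spectral measure of a self-adjoint operator `A` with respect to a vector `ζ`: the Borel
measure `μ` on `ℝ` with `∫ f dμ = (f(A) ζ, ζ)`. -/
def spectralMeasure (A : H →L[ℂ] H) (ζ : H) : MeasureTheory.Measure ℝ :=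
  RealRMK.rieszMeasure (spectralFunctional A ζ)

theorem integral_spectralMeasure (A : H →L[ℂ] H) (ζ : H)
    (f : CompactlySupportedContinuousMap ℝ ℝ) :
    ∫ t, f t ∂(spectralMeasure A ζ) = (⟪ζ, (cfc (fun t : ℝ => f t) A : H →L[ℂ] H) ζ⟫_ℂ).re :=
  RealRMK.integral_rieszMeasure _ f

/-- The set of atoms of a measure on `ℝ`. -/
def atoms (μ : MeasureTheory.Measure ℝ) : Set ℝ := {x | μ {x} ≠ 0}

end Spectral

/-! ### The semigroups `Σ = S ⋉ ℤ₊^J` -/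

/-- The semigroup `S(J) ⋉ ℤ₊^J` over a set `J`. The element with components `perm` and `mult` is
`perm · ∏ j, A_j ^ (mult j)`, where `g A_j g⁻¹ = A_{g j}`. -/
@[ext]
structure Sig (J : Type*) where
  perm : Equiv.Perm J
  mult : J → ℕ

namespace Sig

variable {J : Type*}

instance : Monoid (Sig J) where
  mul s t := ⟨s.perm * t.perm, fun j => s.mult (t.perm j) + t.mult j⟩
  one := ⟨1, fun _ => 0⟩
  mul_assoc s t u := by
    refine Sig.ext (mul_assoc s.perm t.perm u.perm) (funext fun j => ?_)
    exact add_assoc (s.mult (t.perm (u.perm j))) (t.mult (u.perm j)) (u.mult j)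
  one_mul s := Sig.ext (one_mul s.perm) (funext fun j => zero_add (s.mult j))
  mul_one s := Sig.ext (mul_one s.perm) (funext fun j => add_zero (s.mult j))

theorem mul_def (s t : Sig J) :
    s * t = ⟨s.perm * t.perm, fun j => s.mult (t.perm j) + t.mult j⟩ := rfl

theorem one_def : (1 : Sig J) = ⟨1, fun _ => 0⟩ := rfl

/-- The permutation `g` as an element of the semigroup. -/
def ofPerm (g : Equiv.Perm J) : Sig J := ⟨g, fun _ => 0⟩

/-- The generator `A_j` of the semigroup. -/
def gen [DecidableEq J] (j : J) : Sig J := ⟨1, Pi.single j 1⟩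

/-- The embedding of the direct product of the semigroups over the blocks `B x` into the semigroup
over the disjoint union of the blocks. -/
def blockHom {X : Type*} (B : X → Type*) : (∀ x, Sig (B x)) →* Sig (Σ x, B x) where
  toFun s := ⟨Equiv.Perm.sigmaCongrRight fun x => (s x).perm, fun j => (s j.1).mult j.2⟩
  map_one' := rfl
  map_mul' _ _ := rfl

end Sig

/-! ### Irreducible representations of symmetric groups -/

section Specht

variable (l : YoungDiagram)

/-- The cells of a Young diagram, as a type. -/
abbrev Cell : Type := {c : ℕ × ℕ // c ∈ l.cells}

/-- The Young symmetrizer of `l`: the product of the sum over all row preserving permutations of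
the cells and of the signed sum over all column preserving ones. -/
def youngSymmetrizer : ℂ[Equiv.Perm (Cell l)] :=
  (∑ p : Equiv.Perm (Cell l) with ∀ c, (p c).1.1 = c.1.1, MonoidAlgebra.single p (1 : ℂ)) *
  (∑ q : Equiv.Perm (Cell l) with ∀ c, (q c).1.2 = c.1.2,
    MonoidAlgebra.single q (((Equiv.Perm.sign q : ℤ) : ℂ)))

/-- The irreducible module of the symmetric group on the cells of `l` corresponding to `l`, that
is, the left ideal of the group algebra generated by the Young symmetrizer. -/
def specht : Submodule ℂ ℂ[Equiv.Perm (Cell l)] :=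
  LinearMap.range (LinearMap.mulRight ℂ (youngSymmetrizer l))

theorem mul_mem_specht (a b : ℂ[Equiv.Perm (Cell l)]) (hb : b ∈ specht l) :
    a * b ∈ specht l := by
  obtain ⟨c, rfl⟩ := hb
  exact ⟨a * c, by simp [mul_assoc]⟩

/-- The irreducible representation of the symmetric group corresponding to `l`. -/
def spechtRep : Representation ℂ (Equiv.Perm (Cell l)) (specht l) where
  toFun g := (LinearMap.mulLeft ℂ (MonoidAlgebra.single g (1 : ℂ))).restrict
    fun b hb => mul_mem_specht l _ b hb
  map_one' := by
    refine LinearMap.ext fun b => Subtype.ext ?_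
    change MonoidAlgebra.single (1 : Equiv.Perm (Cell l)) (1 : ℂ) *
      (b : ℂ[Equiv.Perm (Cell l)]) = b
    rw [← MonoidAlgebra.one_def, one_mul]
  map_mul' g h := by
    refine LinearMap.ext fun b => Subtype.ext ?_
    change MonoidAlgebra.single (g * h) (1 : ℂ) * (b : ℂ[Equiv.Perm (Cell l)]) =
      MonoidAlgebra.single g (1 : ℂ) * (MonoidAlgebra.single h (1 : ℂ) * b)
    rw [← mul_assoc, MonoidAlgebra.single_mul_single, one_mul]

/-- The module `V_{l,x}`: the symmetric group acts by the irreducible representation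
corresponding to `l` and every generator `A_j` acts by multiplication by `x`. -/
def repV (x : ℝ) : Representation ℂ (Sig (Cell l)) (specht l) where
  toFun s := ((x : ℂ) ^ ∑ c, s.mult c) • spechtRep l s.perm
  map_one' := by simp [Sig.one_def]
  map_mul' s t := by
    have h : ∑ c, s.mult (t.perm c) = ∑ c, s.mult c := Equiv.sum_comp t.perm s.mult
    rw [Sig.mul_def]
    simp only [Finset.sum_add_distrib, h, pow_add, map_mul]
    rw [smul_mul_smul_comm]

end Specht

/-! ### Induction for monoids -/

section Induction

variable {S T : Type*} [Monoid S] [Monoid T] (φ : S →* T) {W : Type*} [AddCommGroup W]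
  [Module ℂ W] (ρ : Representation ℂ S W)

/-- The relations `(a · φ(s)) ⊗ w = a ⊗ ρ(s) w` defining the tensor product over `ℂ[S]`. -/
def indRelations : Submodule ℂ (ℂ[T] ⊗[ℂ] W) :=
  Submodule.span ℂ {z | ∃ (a : ℂ[T]) (s : S) (w : W),
    z = (a * MonoidAlgebra.single (φ s) (1 : ℂ)) ⊗ₜ[ℂ] w - a ⊗ₜ[ℂ] ρ s w}

/-- The induced module `ℂ[T] ⊗_{ℂ[S]} W`. -/
def IndModule : Type _ := (ℂ[T] ⊗[ℂ] W) ⧸ indRelations φ ρ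

instance : AddCommGroup (IndModule φ ρ) :=
  inferInstanceAs (AddCommGroup ((ℂ[T] ⊗[ℂ] W) ⧸ indRelations φ ρ))

instance : Module ℂ (IndModule φ ρ) :=
  inferInstanceAs (Module ℂ ((ℂ[T] ⊗[ℂ] W) ⧸ indRelations φ ρ))

theorem indRelations_le (t : T) :
    indRelations φ ρ ≤ (indRelations φ ρ).comap
      ((LinearMap.mulLeft ℂ (MonoidAlgebra.single t (1 : ℂ))).rTensor W) := by
  refine Submodule.span_le.2 ?_
  rintro _ ⟨a, s, w, rfl⟩
  refine Submodule.subset_span ⟨MonoidAlgebra.single t 1 * a, s, w, ?_⟩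
  simp [mul_assoc]

/-- The class of a tensor in the induced module. -/
def indMk : (ℂ[T] ⊗[ℂ] W) →ₗ[ℂ] IndModule φ ρ := (indRelations φ ρ).mkQ

theorem ind_ext {V : Type*} [AddCommGroup V] [Module ℂ V] {f g : IndModule φ ρ →ₗ[ℂ] V}
    (h : ∀ a w, f (indMk φ ρ (a ⊗ₜ w)) = g (indMk φ ρ (a ⊗ₜ w))) : f = g :=
  Submodule.linearMap_qext _ (TensorProduct.ext' h)

/-- The action of an element of `T` on the induced module, by left multiplication. -/
def indAct (t : T) : IndModule φ ρ →ₗ[ℂ] IndModule φ ρ :=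
  (indRelations φ ρ).mapQ (indRelations φ ρ)
    ((LinearMap.mulLeft ℂ (MonoidAlgebra.single t (1 : ℂ))).rTensor W) (indRelations_le φ ρ t)

theorem indAct_mk (t : T) (a : ℂ[T]) (w : W) :
    indAct φ ρ t (indMk φ ρ (a ⊗ₜ w)) = indMk φ ρ ((MonoidAlgebra.single t (1 : ℂ) * a) ⊗ₜ w) :=
  rfl

/-- The representation of `T` in the induced module. -/
def indRep : Representation ℂ T (IndModule φ ρ) where
  toFun t := indAct φ ρ t
  map_one' := by
    refine ind_ext φ ρ fun a w => ?_
    rw [indAct_mk, ← MonoidAlgebra.one_def, one_mul]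
    rfl
  map_mul' s t := by
    refine ind_ext φ ρ fun a w => ?_
    rw [Module.End.mul_apply, indAct_mk, indAct_mk, indAct_mk, ← mul_assoc,
      MonoidAlgebra.single_mul_single, one_mul]

end Induction

/-! ### Young distributions -/

/-- A Young distribution: a function from `[-1, 1]` to Young diagrams which is the empty diagram
for all but finitely many arguments. -/
structure YoungDistribution where
  toFun : Set.Icc (-1 : ℝ) 1 → YoungDiagram
  finite_ne_bot : {x | toFun x ≠ ⊥}.Finite

namespace YoungDistribution

variable (L : YoungDistribution)

/-- The support `{x | Λ(x) ≠ ∅}` of a Young distribution. -/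
def support : Set ℝ := {x | ∃ h : x ∈ Set.Icc (-1 : ℝ) 1, L.toFun ⟨x, h⟩ ≠ ⊥}

/-- The type of the points of the support. -/
abbrev Point : Type := {x : Set.Icc (-1 : ℝ) 1 // L.toFun x ≠ ⊥}

/-- The disjoint union of the sets of cells of all diagrams `Λ(x)`; it has `|Λ|` elements. -/
abbrev Box : Type := Σ x : L.Point, Cell (L.toFun x.1)

instance : DecidableEq L.Box := Classical.decEq _

/-- The space of `⨂_x V_{Λ(x),x}`. -/
def BlockSpace : Type := ⨂[ℂ] x : L.Point, specht (L.toFun x.1)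

instance : AddCommGroup L.BlockSpace :=
  inferInstanceAs (AddCommGroup (⨂[ℂ] x : L.Point, specht (L.toFun x.1)))

instance : Module ℂ L.BlockSpace :=
  inferInstanceAs (Module ℂ (⨂[ℂ] x : L.Point, specht (L.toFun x.1)))

/-- The module `⨂_x V_{Λ(x),x}` over the direct product of the semigroups of the blocks. -/
def blockRep : Representation ℂ (∀ x : L.Point, Sig (Cell (L.toFun x.1))) L.BlockSpace :=
  PiTensorProduct.mapMonoidHom.comp
    { toFun := fun s x => repV (L.toFun x.1) (x.1 : ℝ) (s x)
      map_one' := by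
        funext x
        simp
      map_mul' := by
        intro s t
        funext x
        simp }

/-- The space of `V_Λ`. -/
abbrev Space : Type := IndModule (W := L.BlockSpace)
  (Sig.blockHom fun x : L.Point => Cell (L.toFun x.1)) L.blockRep

/-- The representation `T_Λ` of the semigroup `S ⋉ ℤ₊^m`, `m = |Λ|`, in the induced module
`V_Λ`. Here the `m` letters are the elements of `L.Box`. -/
def rep : Representation ℂ (Sig L.Box) L.Space :=
  indRep (W := L.BlockSpace) (Sig.blockHom fun x : L.Point => Cell (L.toFun x.1)) L.blockRep

end YoungDistribution

/-! ### The Young distributions of an irreducible admissible representation -/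

section Parameters

variable {H : Type*} [NormedAddCommGroup H] [InnerProductSpace ℂ H] [CompleteSpace H]

/-- The representation `π` of `(G^D, K^D)` of depth `d` corresponds to the pair `(L, M)` of Young
distributions: after numbering the letters of `V_L` by `1, …, d` and those of `V_M` by
`-d, …, -1`, there is an isomorphism `U` of `V_L ⊗ V_M` onto the root `H(π)_d`
which intertwines the actions of `G^D(d)` and of the operators `A_i`, `1 ≤ |i| ≤ d`. -/
def CorrespondsD (π : GD →* unitary (H →L[ℂ] H)) (d : ℕ) (L M : YoungDistribution) : Prop :=
  ∃ (e : L.Box ≃ Set.Icc (1 : ℤ) d) (f : M.Box ≃ Set.Icc (-d : ℤ) (-1))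
    (U : (L.Space ⊗[ℂ] M.Space) →ₗ[ℂ] H),
    Function.Injective U ∧ LinearMap.range U = invariants π d ∧
    (∀ g ∈ finiteLevel GD d, ∀ (s : Equiv.Perm L.Box) (t : Equiv.Perm M.Box),
      (∀ b, (g : Equiv.Perm ℤ) (e b) = e (s b)) → (∀ b, (g : Equiv.Perm ℤ) (f b) = f (t b)) →
      ∀ v, op π g (U v) =
        U (TensorProduct.map (L.rep (Sig.ofPerm s)) (M.rep (Sig.ofPerm t)) v)) ∧
    (∀ b v, opA π (e b) (U v) = U (TensorProduct.map (L.rep (Sig.gen b)) LinearMap.id v)) ∧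
    (∀ b v, opA π (f b) (U v) = U (TensorProduct.map LinearMap.id (M.rep (Sig.gen b)) v))

/-- The representation `π` of `(G^E, K^E)` of depth `d` corresponds to the Young distribution `L`:
after numbering the letters of `V_L` by `±1, …, ±d`, there is an isomorphism `U` of `V_L` onto the
root `H(π)_d` which intertwines the actions of `G^E(d)` and of the operators `A_i`,
`1 ≤ |i| ≤ d`. -/
def CorrespondsE (π : GE →* unitary (H →L[ℂ] H)) (d : ℕ) (L : YoungDistribution) : Prop :=
  ∃ (e : L.Box ≃ {i : ℤ // 1 ≤ |i| ∧ |i| ≤ d}) (U : L.Space →ₗ[ℂ] H),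
    Function.Injective U ∧ LinearMap.range U = invariants π d ∧
    (∀ g ∈ finiteLevel GE d, ∀ s : Equiv.Perm L.Box,
      (∀ b, (g : Equiv.Perm ℤ) (e b) = e (s b)) →
      ∀ v, op π g (U v) = U (L.rep (Sig.ofPerm s) v)) ∧
    (∀ b v, opA π (e b) (U v) = U (L.rep (Sig.gen b) v))

end Parameters

end Olshanski

end

namespace Olshanski

open Filter Topology

/-! ### Atoms of spectral measures and eigenvectors -/

section Atoms

variable {H : Type*} [NormedAddCommGroup H] [InnerProductSpace ℂ H] [CompleteSpace H]

/-! A nonzero point `x` of the support is an eigenvalue of some `A_i`: the module `V_Λ` is generated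
by vectors `1 ⊗ w`, and the generator `A_b` of a box over `x` multiplies each of them by `x`. Let
`v` be an eigenvector of `A_i` in `H(π)` with this eigenvalue, and suppose that `x` is not an atom
for `A_{d+1}` and the root vector `ζ`.

Then `ζ` is orthogonal to the `x`-eigenspace of `A_{d+1}` (`inner_eq_zero_of_notMem_atoms`). As `ζ`
is fixed by `K_d`, the same holds for `A_j` with every `j > d`. It also holds for `j < -d`, since
`A_{d+1}` and `A_{-d-1}` commute and agree on `ζ` (`inner_eq_zero_of_commute`).

The contradiction comes from irreducibility (`eq_zero_of_orthogonal_eigenspaces`). Vectors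
asymptotically orthogonal to the `x`-eigenspaces of the `A_{u n}`, for distinct letters `u n`, form
a closed subspace. It is `G`-invariant because each `g` moves only finitely many letters. It
contains `ζ ≠ 0`, so it is all of `H(π)` and contains `v`. But the transposition `(i, u n)` carries
`v` to an `x`-eigenvector of `A_{u n}`, and its inner product with `v` tends to `⟪v, A_i v⟫ = x
‖v‖²`, which is not zero. -/

/-- The spectral cut-off function `t ↦ 1 - min(1, (k (t - x))²)`. -/
noncomputable def cutoff (k x t : ℝ) : ℝ := 1 - (k * (t - x)) ^ 2 / max 1 ((k * (t - x)) ^ 2)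

theorem cutoff_nonneg (k x t : ℝ) : 0 ≤ cutoff k x t := by
  have h : (0 : ℝ) < max 1 ((k * (t - x)) ^ 2) := lt_max_of_lt_left one_pos
  rw [cutoff, sub_nonneg, div_le_one h]
  exact le_max_right _ _

theorem cutoff_le_one (k x t : ℝ) : cutoff k x t ≤ 1 := by
  rw [cutoff, sub_le_self_iff]
  positivity

theorem continuous_cutoff_denominator_inv (k x : ℝ) :
    Continuous fun t : ℝ => (max 1 ((k * (t - x)) ^ 2))⁻¹ := by
  refine Continuous.inv₀ (by fun_prop) fun t => ?_
  exact (lt_max_of_lt_left one_pos : (0 : ℝ) < max 1 ((k * (t - x)) ^ 2)).ne'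

theorem continuous_cutoff (k x : ℝ) : Continuous (cutoff k x) := by
  have h := continuous_cutoff_denominator_inv k x
  unfold cutoff
  simp only [div_eq_mul_inv]
  fun_prop

theorem cutoff_eq_zero {k x t : ℝ} (h : 1 ≤ |k * (t - x)|) : cutoff k x t = 0 := by
  have h1 : 1 ≤ (k * (t - x)) ^ 2 := by rw [one_le_sq_iff_one_le_abs]; exact h
  rw [cutoff, max_eq_right h1, div_self (by positivity), sub_self]

theorem hasCompactSupport_cutoff {k : ℝ} (hk : 0 < k) (x : ℝ) :
    HasCompactSupport (cutoff k x) := by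
  refine HasCompactSupport.intro (isCompact_closedBall x k⁻¹) fun t ht => cutoff_eq_zero ?_
  rw [Metric.mem_closedBall, Real.dist_eq, not_le, inv_lt_iff_one_lt_mul₀' hk] at ht
  rw [abs_mul, abs_of_pos hk]
  exact ht.le

/-- The continuous functional calculus of the cut-off function at `x` fixes the eigenvectors with
eigenvalue `x`. -/
theorem cfc_cutoff_apply {A : H →L[ℂ] H} (hA : IsSelfAdjoint A) (k x : ℝ) {θ : H}
    (hθ : A θ = (x : ℂ) • θ) : (cfc (cutoff k x) A : H →L[ℂ] H) θ = θ := by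
  -- Off by the factor `t - x`, the part `1 - cutoff` is still continuous, so `f(A) = 1 - q(A)(A -
  -- x)`, whose last factor kills `θ`. This is why the cut-off is quadratic at `x`.
  set q : ℝ → ℝ := fun t => k * (k * (t - x)) * (max 1 ((k * (t - x)) ^ 2))⁻¹ with hq
  have hqc : Continuous q := by
    have h := continuous_cutoff_denominator_inv k x
    rw [hq]
    fun_prop
  have e : cutoff k x = fun t => 1 - q t * (t - x) := by
    funext t
    rw [cutoff, hq, div_eq_mul_inv]
    ring
  have h1 : cfc (cutoff k x) A = 1 - cfc q A * (A - algebraMap ℝ (H →L[ℂ] H) x) := by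
    rw [e, cfc_sub (fun _ : ℝ => (1 : ℝ)) (fun t => q t * (t - x)) A (by fun_prop) (by fun_prop),
      cfc_const_one ℝ A,
      cfc_mul q (fun t => t - x) A (by fun_prop) (by fun_prop),
      cfc_sub (fun t : ℝ => t) (fun _ => x) A (by fun_prop) (by fun_prop), cfc_id' ℝ A,
      cfc_const x A]
  have h2 : (A - algebraMap ℝ (H →L[ℂ] H) x) θ = 0 := by
    rw [Algebra.algebraMap_eq_smul_one]
    simp [hθ]
  rw [h1]
  simp [h2]

/-- If `x` is not an atom of the spectral measure of `ζ`, then `ζ` is orthogonal to the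
eigenvectors with eigenvalue `x`. -/
theorem inner_eq_zero_of_notMem_atoms {A : H →L[ℂ] H} (hA : IsSelfAdjoint A) {x : ℝ} {ζ θ : H}
    (hx : x ∉ atoms (spectralMeasure A ζ)) (hθ : A θ = (x : ℂ) • θ) : ⟪θ, ζ⟫_ℂ = 0 := by
  have hx0 : spectralMeasure A ζ {x} = 0 := by simpa [atoms] using hx
  have hreg : (spectralMeasure A ζ).Regular := RealRMK.regular_rieszMeasure _
  suffices h : ∀ ε : ℝ, 0 < ε → ‖⟪θ, ζ⟫_ℂ‖ ^ 2 ≤ ‖θ‖ ^ 2 * ε by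
    by_contra hne
    have hpos : 0 < ‖⟪θ, ζ⟫_ℂ‖ ^ 2 := by positivity
    -- This `ε` makes the right-hand side at most half of the left-hand side.
    have h1 := h (‖⟪θ, ζ⟫_ℂ‖ ^ 2 / (2 * (‖θ‖ ^ 2 + 1))) (by positivity)
    rw [mul_div_assoc', le_div_iff₀ (by positivity)] at h1
    nlinarith [sq_nonneg ‖θ‖]
  intro ε hε
  -- Outer regularity gives the null set `{x}` a neighbourhood of measure less than `ε`. It contains
  -- a ball of radius `r`, and the cut-off of slope parameter `1/r` vanishes outside that ball.
  obtain ⟨U, hxU, hU, hμU⟩ := Set.exists_isOpen_lt_of_lt {x} (ENNReal.ofReal ε)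
    (μ := spectralMeasure A ζ) (by rw [hx0]; exact ENNReal.ofReal_pos.2 hε)
  obtain ⟨r, hr, hrU⟩ := Metric.isOpen_iff.1 hU x (hxU rfl)
  set f : CompactlySupportedContinuousMap ℝ ℝ :=
    ⟨⟨cutoff r⁻¹ x, continuous_cutoff _ _⟩, hasCompactSupport_cutoff (inv_pos.2 hr) x⟩ with hf
  have hfc : ∀ t, f t = cutoff r⁻¹ x t := fun _ => rfl
  have hint : ∫ t, (f * f) t ∂(spectralMeasure A ζ) ≤ ε := by
    have hle : ∀ t, (f * f) t ≤ U.indicator (fun _ => (1 : ℝ)) t := by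
      intro t
      rw [CompactlySupportedContinuousMap.mul_apply, hfc]
      by_cases ht : t ∈ U
      · rw [Set.indicator_of_mem ht]
        exact mul_le_one₀ (cutoff_le_one _ _ _) (cutoff_nonneg _ _ _) (cutoff_le_one _ _ _)
      · rw [Set.indicator_of_notMem ht, cutoff_eq_zero, mul_zero]
        by_contra hcon
        refine ht (hrU ?_)
        rw [not_le, abs_mul, abs_of_pos (inv_pos.2 hr), inv_mul_lt_one₀ hr] at hcon
        rwa [Metric.mem_ball, Real.dist_eq]
    have hUm : MeasurableSet U := hU.measurableSet
    calc ∫ t, (f * f) t ∂(spectralMeasure A ζ)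
        ≤ ∫ t, U.indicator (fun _ => (1 : ℝ)) t ∂(spectralMeasure A ζ) := by
          refine MeasureTheory.integral_mono_of_nonneg (Eventually.of_forall fun t => ?_) ?_
            (Eventually.of_forall hle)
          · exact mul_self_nonneg (f t)
          · exact (MeasureTheory.integrable_indicator_iff hUm).2
              (MeasureTheory.integrableOn_const (hμU.trans ENNReal.ofReal_lt_top).ne)
      _ = (spectralMeasure A ζ).real U := by
          rw [MeasureTheory.integral_indicator_const _ hUm, smul_eq_mul, mul_one]
      _ ≤ ε := ENNReal.toReal_le_of_le_ofReal hε.le hμU.le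
  have hcont : ContinuousOn (fun t => f t) (spectrum ℝ A) := f.continuous.continuousOn
  set B : H →L[ℂ] H := cfc (fun t : ℝ => f t) A with hB
  have hBsa : IsSelfAdjoint B := cfc_predicate _ _
  have hBin : ∀ a b, ⟪B a, b⟫_ℂ = ⟪a, B b⟫_ℂ := fun a b => hBsa.isSymmetric a b
  -- The square of `f` is integrated because `∫ f² dμ = ⟪ζ, f(A)² ζ⟫ = ‖f(A) ζ‖²`.
  have hnorm : ‖B ζ‖ ^ 2 ≤ ε := by
    rw [integral_spectralMeasure] at hint
    have e : cfc (fun t : ℝ => (f * f) t) A = B * B := by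
      rw [hB, ← cfc_mul (fun t => f t) (fun t => f t) A hcont hcont]
      rfl
    rw [e, mul_apply_eq_comp, ← hBin, inner_self_eq_norm_sq_to_K] at hint
    exact_mod_cast hint
  have hBθ : B θ = θ := cfc_cutoff_apply hA _ x hθ
  calc ‖⟪θ, ζ⟫_ℂ‖ ^ 2 = ‖⟪θ, B ζ⟫_ℂ‖ ^ 2 := by rw [← hBin, hBθ]
    _ ≤ (‖θ‖ * ‖B ζ‖) ^ 2 := by gcongr; exact norm_inner_le_norm _ _
    _ = ‖θ‖ ^ 2 * ‖B ζ‖ ^ 2 := mul_pow _ _ _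
    _ ≤ ‖θ‖ ^ 2 * ε := by gcongr

/-- Let `A` and `B` be commuting self-adjoint operators which agree at `ζ`. If `ζ` is orthogonal to
an eigenspace of `A`, it is orthogonal to the eigenspace of `B` with the same eigenvalue. -/
theorem inner_eq_zero_of_commute {A B : H →L[ℂ] H} (hA : IsSelfAdjoint A)
    (hB : IsSelfAdjoint B) (hAB : A * B = B * A) {x : ℝ} {ζ : H} (hζ : A ζ = B ζ)
    (h : ∀ θ, A θ = (x : ℂ) • θ → ⟪θ, ζ⟫_ℂ = 0) {θ : H} (hθ : B θ = (x : ℂ) • θ) :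
    ⟪θ, ζ⟫_ℂ = 0 := by
  have hcomm : ∀ a, A (B a) = B (A a) := fun a => DFunLike.congr_fun hAB a
  set E : Submodule ℂ H := LinearMap.ker ((B - (x : ℂ) • (1 : H →L[ℂ] H)) : H →ₗ[ℂ] H) with hE
  have hmem : ∀ a, a ∈ E ↔ B a = (x : ℂ) • a := fun a => by
    rw [hE, LinearMap.mem_ker]
    simp [sub_eq_zero]
  have hcl : IsClosed (E : Set H) :=
    ContinuousLinearMap.isClosed_ker (B - (x : ℂ) • (1 : H →L[ℂ] H))
  have : CompleteSpace E := hcl.completeSpace_coe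
  have hAE : ∀ a ∈ E, A a ∈ E := fun a ha => by
    rw [hmem] at ha ⊢
    rw [← hcomm, ha, map_smul]
  have hBE : ∀ a ∈ E, B a ∈ E := fun a ha => by
    rw [hmem] at ha ⊢
    rw [ha, map_smul, ha]
  have hperp : ∀ C : H →L[ℂ] H, IsSelfAdjoint C → (∀ a ∈ E, C a ∈ E) → ∀ a ∈ Eᗮ, C a ∈ Eᗮ := by
    intro C hC hCE a ha
    rw [Submodule.mem_orthogonal] at ha ⊢
    intro b hb
    have e : ⟪C b, a⟫_ℂ = ⟪b, C a⟫_ℂ := hC.isSymmetric b a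
    rw [← e]
    exact ha _ (hCE b hb)
  set p := E.starProjection ζ with hp
  have hpE : p ∈ E := E.starProjection_apply_mem ζ
  have hrE : ζ - p ∈ Eᗮ := E.sub_starProjection_mem_orthogonal ζ
  -- The eigenspace `E` of `B` and its complement are stable under both operators, so the components
  -- of `(A - B) ζ = 0` in them vanish separately. Hence the projection `p` of `ζ` to `E` is an
  -- eigenvector of `A` too.
  have h1 : A p - B p = B (ζ - p) - A (ζ - p) := by
    rw [map_sub, map_sub, hζ]
    abel
  have h2 : A p - B p = 0 := by
    refine (Submodule.mem_bot ℂ).1 (E.inf_orthogonal_eq_bot ▸ ⟨?_, ?_⟩)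
    · exact E.sub_mem (hAE p hpE) (hBE p hpE)
    · rw [h1]
      exact Eᗮ.sub_mem (hperp B hB hBE _ hrE) (hperp A hA hAE _ hrE)
  have h3 : ⟪p, ζ⟫_ℂ = 0 := h p (by rw [sub_eq_zero.1 h2, (hmem p).1 hpE])
  -- Both `⟪p, ζ⟫` and `⟪p, ζ - p⟫` vanish, hence so does `‖p‖²`.
  have h4 : p = 0 := by
    have h5 := (Submodule.mem_orthogonal E _).1 hrE p hpE
    rw [inner_sub_right, h3, zero_sub, neg_eq_zero] at h5
    exact inner_self_eq_zero.1 h5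
  rw [h4, sub_zero] at hrE
  exact (Submodule.mem_orthogonal E _).1 hrE θ ((hmem θ).2 hθ)

end Atoms

/-! ### Transpositions in the groups -/

theorem swap_mem_GE {i j : ℤ} (hi : i ≠ 0) (hj : j ≠ 0) : Equiv.swap i j ∈ GE := by
  refine ⟨?_, Equiv.swap_apply_of_ne_of_ne hi.symm hj.symm⟩
  refine (Set.toFinite {i, j}).subset fun k hk => ?_
  by_contra h
  simp only [Set.mem_insert_iff, Set.mem_singleton_iff, not_or] at h
  exact hk (Equiv.swap_apply_of_ne_of_ne h.1 h.2)

theorem swap_mem_GD {i j : ℤ} (h : 0 < i ∧ 0 < j ∨ i < 0 ∧ j < 0) : Equiv.swap i j ∈ GD := by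
  have hE : Equiv.swap i j ∈ GE := swap_mem_GE (by omega) (by omega)
  refine ⟨hE.1, hE.2, ?_⟩
  ext k
  obtain ⟨l, rfl⟩ := (Equiv.swap i j).surjective k
  rw [(Equiv.swap i j).injective.mem_set_image, Set.mem_ofPred_eq, Set.mem_ofPred_eq,
    Equiv.swap_apply_def]
  split_ifs <;> omega

theorem GD_le_GE : GD ≤ GE := fun _ h => ⟨h.1, h.2.1⟩

/-! ### Relations between the operators `A_i` and the action of `G` -/

section Operators

variable {G : Subgroup (Equiv.Perm ℤ)} {H : Type*} [NormedAddCommGroup H]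
  [InnerProductSpace ℂ H] [CompleteSpace H]

/-- A single transposition of `i` and `j` on one side of zero does not respect `i ↦ -i`. Its product
with the mirror transposition does, so it moves letters beyond `d` while fixing every
`K_d`-invariant vector. -/
theorem swap_mul_swap_neg_mem_tailK (hG : GD ≤ G) {d : ℕ} {i j : ℤ}
    (h : (d : ℤ) < i ∧ (d : ℤ) < j ∨ i < -d ∧ j < -d) :
    ∃ hm : Equiv.swap i j * Equiv.swap (-i) (-j) ∈ G, (⟨_, hm⟩ : G) ∈ tailK G d := by
  refine ⟨hG (GD.mul_mem (swap_mem_GD (by omega)) (swap_mem_GD (by omega))), fun k => ?_,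
    fun k hk => ?_⟩
  · simp only [Equiv.Perm.mul_apply, Equiv.swap_apply_def]
    split_ifs <;> omega
  · rw [abs_le] at hk
    simp only [Equiv.Perm.mul_apply, Equiv.swap_apply_def]
    split_ifs <;> omega

theorem op_inv_apply_op (π : G →* unitary (H →L[ℂ] H)) (g : G) (ζ : H) :
    op π g⁻¹ (op π g ζ) = ζ := by
  rw [← op_mul, inv_mul_cancel]
  simp [op]

theorem op_apply_op_inv (π : G →* unitary (H →L[ℂ] H)) (g : G) (ζ : H) :
    op π g (op π g⁻¹ ζ) = ζ := by
  rw [← op_mul, mul_inv_cancel]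
  simp [op]

theorem inner_op_right (π : G →* unitary (H →L[ℂ] H)) (g : G) (ζ η : H) :
    ⟪η, op π g ζ⟫_ℂ = ⟪op π g⁻¹ η, ζ⟫_ℂ := by
  conv_rhs => rw [← inner_op_op π g, op_apply_op_inv]

/-- An injective sequence leaves every finite set, so the weak limit may be computed along any
convenient choice of distinct letters. -/
theorem IsTranspositionLimit.tendsto {π : G →* unitary (H →L[ℂ] H)} {i : ℤ} {A : H →L[ℂ] H}
    (hA : IsTranspositionLimit π i A) {u : ℕ → ℤ} (hu : Function.Injective u)
    (huG : ∀ n, Equiv.swap i (u n) ∈ G) (ζ η : H) :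
    Tendsto (fun n => ⟪η, op π ⟨Equiv.swap i (u n), huG n⟩ ζ⟫_ℂ) atTop (𝓝 ⟪η, A ζ⟫_ℂ) := by
  have hinj : Function.Injective
      fun n => (⟨u n, huG n⟩ : {n : ℤ // Equiv.swap i n ∈ G}) :=
    fun a b h => hu (Subtype.ext_iff.1 h)
  have h := Nat.cofinite_eq_atTop ▸ hinj.tendsto_cofinite
  have h1 := (hA ζ η).comp h
  simpa only [Function.comp_def] using h1

/-- The sequence `1, 2, …` if `i > 0` and `-1, -2, …` otherwise. -/
def sameSign (i : ℤ) (n : ℕ) : ℤ := if 0 < i then n + 1 else -(n + 1)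

theorem sameSign_injective (i : ℤ) : Function.Injective (sameSign i) := by
  intro a b h
  simp only [sameSign] at h
  split_ifs at h <;> omega

theorem swap_sameSign_mem (hG : GD ≤ G) {i : ℤ} (hi : i ≠ 0) (n : ℕ) :
    Equiv.swap i (sameSign i n) ∈ G := by
  refine hG (swap_mem_GD ?_)
  simp only [sameSign]
  split_ifs <;> omega

theorem swap_subtype_inv {i j : ℤ} (h : Equiv.swap i j ∈ G) :
    (⟨Equiv.swap i j, h⟩ : G)⁻¹ = ⟨Equiv.swap i j, h⟩ :=
  Subtype.ext (Equiv.swap_inv i j)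

variable {π : G →* unitary (H →L[ℂ] H)}

/-- Transpositions act by self-adjoint operators, being unitary involutions, and self-adjointness
survives weak limits. -/
theorem isSelfAdjoint_opA (hG : GD ≤ G) (hlim : ∀ i, IsTranspositionLimit π i (opA π i)) {i : ℤ}
    (hi : i ≠ 0) : IsSelfAdjoint (opA π i) := by
  rw [ContinuousLinearMap.isSelfAdjoint_iff_isSymmetric]
  intro ζ η
  have hmem := swap_sameSign_mem hG hi
  have h1 := (hlim i).tendsto (sameSign_injective i) hmem η ζ
  have h2 := (Complex.continuous_conj.tendsto _).comp
    ((hlim i).tendsto (sameSign_injective i) hmem ζ η)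
  rw [inner_conj_symm] at h2
  refine tendsto_nhds_unique h2 (h1.congr fun n => ?_)
  rw [inner_op_right, swap_subtype_inv]
  exact (inner_conj_symm _ _).symm

/-- The relation `g A_i g⁻¹ = A_{g i}`. -/
theorem op_opA (hG : GD ≤ G) (hlim : ∀ i, IsTranspositionLimit π i (opA π i)) {i : ℤ}
    (hi : i ≠ 0) (g : G) (ζ : H) :
    op π g (opA π i ζ) = opA π ((g : Equiv.Perm ℤ) i) (op π g ζ) := by
  refine ext_inner_left ℂ fun η => ?_
  have hmem := swap_sameSign_mem hG hi
  -- Conjugation by `g` turns `(i, u n)` into `(g i, g (u n))`, and `g ∘ u` is again injective, so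
  -- both sides are limits of the same numbers.
  have e : ∀ n, Equiv.swap ((g : Equiv.Perm ℤ) i) ((g : Equiv.Perm ℤ) (sameSign i n)) =
      g * Equiv.swap i (sameSign i n) * (g : Equiv.Perm ℤ)⁻¹ := fun n =>
    Equiv.swap_apply_apply _ _ _
  have hmem' : ∀ n,
      Equiv.swap ((g : Equiv.Perm ℤ) i) ((g : Equiv.Perm ℤ) (sameSign i n)) ∈ G := fun n => by
    rw [e]
    exact G.mul_mem (G.mul_mem g.2 (hmem n)) (G.inv_mem g.2)
  have h1 := (hlim i).tendsto (sameSign_injective i) hmem ζ (op π g⁻¹ η)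
  have h2 := (hlim _).tendsto ((g : Equiv.Perm ℤ).injective.comp (sameSign_injective i)) hmem'
    (op π g ζ) η
  rw [inner_op_right]
  refine tendsto_nhds_unique h1 (h2.congr fun n => ?_)
  rw [← inner_op_right, ← op_mul, ← op_mul]
  congr 3
  exact Subtype.ext (by simp [e])

/-- Each transposition `(-j, n)` with `n < 0` fixes the letter `j` and therefore commutes with
`A_j`; pass to the weak limit in `n`. -/
theorem opA_commute_neg (hG : GD ≤ G) (hlim : ∀ i, IsTranspositionLimit π i (opA π i)) {j : ℤ}
    (hj : 0 < j) : opA π j * opA π (-j) = opA π (-j) * opA π j := by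
  have hmem := swap_sameSign_mem hG (i := -j) (by omega)
  refine ContinuousLinearMap.ext fun ζ => ext_inner_left ℂ fun η => ?_
  have hsa : ∀ a b, ⟪opA π j a, b⟫_ℂ = ⟪a, opA π j b⟫_ℂ := fun a b =>
    (isSelfAdjoint_opA hG hlim hj.ne').isSymmetric a b
  rw [mul_apply_eq_comp, mul_apply_eq_comp, ← hsa]
  have h1 := (hlim (-j)).tendsto (sameSign_injective (-j)) hmem ζ (opA π j η)
  have h2 := (hlim (-j)).tendsto (sameSign_injective (-j)) hmem (opA π j ζ) η
  refine tendsto_nhds_unique h1 (h2.congr fun n => ?_)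
  rw [hsa, op_opA hG hlim hj.ne']
  congr 2
  refine congrArg (opA π) (Equiv.swap_apply_of_ne_of_ne (by omega) ?_)
  simp only [sameSign]
  split_ifs <;> omega

/-- On the `K_d`-invariant vectors `A_j = A_{-j}` for `j > d`. -/
theorem opA_neg_apply (hG : GD ≤ G) (hlim : ∀ i, IsTranspositionLimit π i (opA π i)) {d : ℕ}
    {j : ℤ} (hj : (d : ℤ) < j) {ζ : H} (hζ : ζ ∈ invariants π d) :
    opA π j ζ = opA π (-j) ζ := by
  refine ext_inner_left ℂ fun η => ?_
  have hinj : Function.Injective fun n : ℕ => (d : ℤ) + 1 + n := fun a b h => by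
    simpa using h
  have hinj' : Function.Injective fun n : ℕ => -((d : ℤ) + 1 + n) := fun a b h => by
    simpa using h
  have hmem : ∀ n : ℕ, Equiv.swap j ((d : ℤ) + 1 + n) ∈ G := fun n =>
    hG (swap_mem_GD (by omega))
  have hmem' : ∀ n : ℕ, Equiv.swap (-j) (-((d : ℤ) + 1 + n)) ∈ G := fun n =>
    hG (swap_mem_GD (by omega))
  have h1 := (hlim j).tendsto hinj hmem ζ η
  have h2 := (hlim (-j)).tendsto hinj' hmem' ζ η
  refine tendsto_nhds_unique h1 (h2.congr fun n => ?_)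
  obtain ⟨hm, hk⟩ := swap_mul_swap_neg_mem_tailK hG (d := d) (i := j) (j := (d : ℤ) + 1 + n)
    (by omega)
  -- With `n` standing for `d + 1 + n`, the element `(j, n)(-j, -n)` lies in `K_d` and fixes `ζ`, so
  -- the involution `(j, n)` and its mirror image agree on `ζ`.
  have h3 : op π ⟨_, hmem n⟩ (op π ⟨_, hmem' n⟩ ζ) = ζ := by
    rw [← op_mul]
    exact hζ _ hk
  congr 1
  conv_rhs => rw [← h3, ← swap_subtype_inv (hmem n)]
  exact (op_inv_apply_op π _ _).symm

/-- A `K_d`-invariant vector orthogonal to an eigenspace of `A_j`, where `|j| > d`, is orthogonal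
to the corresponding eigenspace of `A_k` for all `k` with `|k| > d` of the same sign. -/
theorem inner_eigenvector_eq_zero (hG : GD ≤ G)
    (hlim : ∀ i, IsTranspositionLimit π i (opA π i)) {d : ℕ} {j k : ℤ}
    (h : (d : ℤ) < j ∧ (d : ℤ) < k ∨ j < -d ∧ k < -d) {ζ : H} (hζ : ζ ∈ invariants π d) {c : ℂ}
    (horth : ∀ θ, opA π j θ = c • θ → ⟪θ, ζ⟫_ℂ = 0) {θ : H} (hθ : opA π k θ = c • θ) :
    ⟪θ, ζ⟫_ℂ = 0 := by
  have hj : j ≠ 0 ∧ j ≠ -j ∧ j ≠ -k := by omega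
  have hk0 : k ≠ 0 := by omega
  obtain ⟨hm, hk⟩ := swap_mul_swap_neg_mem_tailK hG (d := d) (i := j) (j := k) h
  set g : G := ⟨_, hm⟩
  have hgk : ((g⁻¹ : G) : Equiv.Perm ℤ) k = j := by
    have : (g : Equiv.Perm ℤ) j = k := by
      change Equiv.swap j k (Equiv.swap (-j) (-k) j) = k
      rw [Equiv.swap_apply_of_ne_of_ne hj.2.1 hj.2.2, Equiv.swap_apply_left]
    rw [Subgroup.coe_inv, Equiv.Perm.inv_eq_iff_eq, this]
  -- The element `g` of `K_d` fixes `ζ`, while its inverse carries the eigenspace of `A_k` to that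
  -- of `A_j`.
  have h1 := horth (op π g⁻¹ θ) (by
    rw [← hgk, ← op_opA hG hlim hk0, hθ, map_smul])
  rwa [← inner_op_right, hζ g hk] at h1

/-! ### Asymptotic orthogonality and irreducibility -/

/-- In an irreducible representation, a nonzero vector cannot be orthogonal to the eigenspaces with
eigenvalue `x ≠ 0` of `A_{u 0}, A_{u 1}, …` if `x` is an eigenvalue of `A_i`. -/
theorem eq_zero_of_orthogonal_eigenspaces (hG : GD ≤ G) (hGE : G ≤ GE)
    (hlim : ∀ i, IsTranspositionLimit π i (opA π i)) (hirr : IsIrreducible π) {i : ℤ} (hi : i ≠ 0)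
    {c : ℂ} (hc : c ≠ 0) {v : H} (hv0 : v ≠ 0) (hv : opA π i v = c • v) {u : ℕ → ℤ}
    (hu : Function.Injective u) (hu0 : ∀ n, u n ≠ 0) (huG : ∀ n, Equiv.swap i (u n) ∈ G) {ζ : H}
    (hζ : ∀ n θ, opA π (u n) θ = c • θ → ⟪θ, ζ⟫_ℂ = 0) : ζ = 0 := by
  -- Exact orthogonality to all these eigenspaces need not be `G`-invariant. Requiring the
  -- eigenvector equation only eventually gives invariance, and the bound on `θ` gives closedness.
  let W : Submodule ℂ H :=
    { carrier := {ξ | ∀ θ : ℕ → H, (∀ᶠ n in atTop, opA π (u n) (θ n) = c • θ n) →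
        (∀ n, ‖θ n‖ ≤ 1) → Tendsto (fun n => ⟪θ n, ξ⟫_ℂ) atTop (𝓝 0)}
      zero_mem' := fun θ _ _ => by simp
      add_mem' := fun {a b} ha hb θ h1 h2 => by
        have := (ha θ h1 h2).add (hb θ h1 h2)
        simpa only [inner_add_right, add_zero] using this
      smul_mem' := fun r a ha θ h1 h2 => by
        have := (ha θ h1 h2).const_mul r
        simpa only [inner_smul_right, mul_zero] using this }
  have hcl : IsClosed (W : Set H) := by
    refine isClosed_of_closure_subset fun ξ hξ θ h1 h2 => ?_
    rw [Metric.tendsto_atTop]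
    intro ε hε
    obtain ⟨ξ', hξ', hd⟩ := Metric.mem_closure_iff.1 hξ (ε / 2) (by positivity)
    obtain ⟨N, hN⟩ := Metric.tendsto_atTop.1 (hξ' θ h1 h2) (ε / 2) (by positivity)
    refine ⟨N, fun n hn => ?_⟩
    have h3 := hN n hn
    rw [dist_zero_right] at h3 ⊢
    rw [dist_eq_norm] at hd
    have e : ⟪θ n, ξ⟫_ℂ = ⟪θ n, ξ - ξ'⟫_ℂ + ⟪θ n, ξ'⟫_ℂ := by rw [← inner_add_right]; simp
    have h4 : ‖⟪θ n, ξ - ξ'⟫_ℂ‖ ≤ ‖ξ - ξ'‖ :=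
      (norm_inner_le_norm _ _).trans (mul_le_of_le_one_left (norm_nonneg _) (h2 n))
    rw [e]
    linarith [norm_add_le ⟪θ n, ξ - ξ'⟫_ℂ ⟪θ n, ξ'⟫_ℂ]
  have hinv : ∀ g : G, ∀ ξ ∈ W, op π g ξ ∈ W := by
    intro g ξ hξ θ h1 h2
    simp only [inner_op_right]
    refine hξ (fun n => op π g⁻¹ (θ n)) ?_ fun n => (norm_op_apply π _ _).trans_le (h2 n)
    -- For large `n` the letter `u n` is fixed by the inverse of `g`, which then preserves the
    -- eigenspace of `A_{u n}`.
    have hfin : {k : ℤ | ((g⁻¹ : G) : Equiv.Perm ℤ) k ≠ k}.Finite := (hGE (g⁻¹).2).1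
    have hev := hu.tendsto_cofinite.eventually hfin.eventually_cofinite_notMem
    rw [Nat.cofinite_eq_atTop] at hev
    filter_upwards [h1, hev] with n h3 h4
    simp only [not_not] at h4
    rw [← map_smul, ← h3, op_opA hG hlim (hu0 n), h4]
  have hζW : ζ ∈ W := fun θ h1 _ =>
    tendsto_const_nhds.congr' (h1.mono fun n hn => (hζ n (θ n) hn).symm)
  rcases hirr.2 W hcl hinv with hW | hW
  · rw [hW] at hζW
    exact (Submodule.mem_bot ℂ).1 hζW
  exfalso
  have hvW : v ∈ W := by rw [hW]; trivial
  set w : H := (‖v‖⁻¹ : ℂ) • v with hw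
  have hw1 : ‖w‖ = 1 := by
    rw [hw, norm_smul, norm_inv, Complex.norm_real, norm_norm,
      inv_mul_cancel₀ (norm_ne_zero_iff.2 hv0)]
  have hwA : opA π i w = c • w := by rw [hw, map_smul, hv, smul_comm]
  -- The vectors `(i, u n) w` are unit eigenvectors of `A_{u n}`, hence an admissible test sequence
  -- for `v ∈ W`. The same inner products also converge to `⟪w, A_i v⟫ = c ⟪w, v⟫ ≠ 0`.
  have h1 : Tendsto (fun n => ⟪op π ⟨Equiv.swap i (u n), huG n⟩ w, v⟫_ℂ) atTop (𝓝 0) := by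
    refine hvW _ (Eventually.of_forall fun n => ?_) fun n => by rw [norm_op_apply, hw1]
    have h := op_opA hG hlim hi ⟨Equiv.swap i (u n), huG n⟩ w
    rw [hwA, map_smul, Equiv.swap_apply_left] at h
    exact h.symm
  have h2 := (hlim i).tendsto hu huG v w
  have h3 := tendsto_nhds_unique h2 (h1.congr fun n => by rw [inner_op_right, swap_subtype_inv])
  rw [hv, inner_smul_right, mul_eq_zero, hw, inner_smul_left, mul_eq_zero] at h3
  simp [hc, hv0] at h3

/-- If `x ≠ 0` is an eigenvalue of `A_i`, then `x` is an atom of the spectral measure of `A_{d+1}`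
with respect to every nonzero `K_d`-invariant vector. -/
theorem mem_atoms_of_eigenvector (hG : GD ≤ G) (hGE : G ≤ GE)
    (hlim : ∀ i, IsTranspositionLimit π i (opA π i)) (hirr : IsIrreducible π) {i : ℤ} (hi : i ≠ 0)
    {d : ℕ} (hiG : (∀ j : ℤ, (d : ℤ) < j → Equiv.swap i j ∈ G) ∨
      ∀ j : ℤ, j < -d → Equiv.swap i j ∈ G)
    {x : ℝ} (hx : x ≠ 0) {v : H} (hv0 : v ≠ 0) (hv : opA π i v = (x : ℂ) • v) {ζ : H}
    (hζ0 : ζ ≠ 0) (hζ : ζ ∈ invariants π d) :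
    x ∈ atoms (spectralMeasure (opA π (d + 1)) ζ) := by
  by_contra hxa
  have hsa : IsSelfAdjoint (opA π ((d : ℤ) + 1)) := isSelfAdjoint_opA hG hlim (by omega)
  have horth : ∀ θ, opA π ((d : ℤ) + 1) θ = (x : ℂ) • θ → ⟪θ, ζ⟫_ℂ = 0 := fun θ hθ =>
    inner_eq_zero_of_notMem_atoms hsa hxa hθ
  -- The negative side is needed for `G^D`, where a negative letter `i` can be exchanged with
  -- negative letters only.
  have horth' : ∀ θ, opA π (-((d : ℤ) + 1)) θ = (x : ℂ) • θ → ⟪θ, ζ⟫_ℂ = 0 := fun θ hθ =>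
    inner_eq_zero_of_commute hsa (isSelfAdjoint_opA hG hlim (by omega))
      (opA_commute_neg hG hlim (by omega)) (opA_neg_apply hG hlim (by omega) hζ) horth hθ
  have hxc : (x : ℂ) ≠ 0 := by exact_mod_cast hx
  rcases hiG with h | h
  · exact hζ0 (eq_zero_of_orthogonal_eigenspaces hG hGE hlim hirr hi hxc hv0 hv
      (u := fun n => (d : ℤ) + 1 + n) (fun a b hab => by simpa using hab) (fun n => by omega)
      (fun n => h _ (by omega))
      fun n θ hθ => inner_eigenvector_eq_zero hG hlim (by omega) hζ horth hθ)
  · exact hζ0 (eq_zero_of_orthogonal_eigenspaces hG hGE hlim hirr hi hxc hv0 hv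
      (u := fun n => -((d : ℤ) + 1 + n)) (fun a b hab => by simpa using hab) (fun n => by omega)
      (fun n => h _ (by omega))
      fun n θ hθ => inner_eigenvector_eq_zero hG hlim (by omega) hζ horth' hθ)

end Operators

/-! ### Eigenvectors in the modules `V_Λ` -/

namespace YoungDistribution

variable (L : YoungDistribution)

theorem exists_box_of_mem_support {x : ℝ} (hx : x ∈ L.support) : ∃ b : L.Box, (b.1.1 : ℝ) = x := by
  obtain ⟨h, hne⟩ := hx
  have hc : (L.toFun ⟨x, h⟩).cells.Nonempty := by
    rw [Finset.nonempty_iff_ne_empty]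
    exact fun h0 => hne (YoungDiagram.ext h0)
  obtain ⟨c, hc⟩ := hc
  exact ⟨⟨⟨⟨x, h⟩, hne⟩, ⟨c, hc⟩⟩, rfl⟩

/-- The class of a tensor in `V_Λ`. -/
noncomputable abbrev spaceMk : (ℂ[Sig L.Box] ⊗[ℂ] L.BlockSpace) →ₗ[ℂ] L.Space :=
  indMk (W := L.BlockSpace) (Sig.blockHom fun x : L.Point => Cell (L.toFun x.1)) L.blockRep

/-- The vectors `1 ⊗ w` generate the induced module, since `a ⊗ w` is a combination of their
translates. -/
theorem spaceMk_mem (a : ℂ[Sig L.Box]) (w : L.BlockSpace) (V : Submodule ℂ L.Space)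
    (h : ∀ t : Sig L.Box, L.rep t (L.spaceMk (1 ⊗ₜ w)) ∈ V) :
    L.spaceMk (a ⊗ₜ w) ∈ V := by
  induction a using MonoidAlgebra.induction_linear with
  | zero => simp
  | add a b ha hb =>
    rw [TensorProduct.add_tmul, map_add]
    exact V.add_mem ha hb
  | single t r =>
    have e : (MonoidAlgebra.single t r : ℂ[Sig L.Box]) = r • (MonoidAlgebra.single t 1 * 1) := by
      simp
    rw [e, ← TensorProduct.smul_tmul', map_smul]
    exact V.smul_mem r (h t)

open Classical in
/-- The generator `A_b` as an element of the direct product of the semigroups of the blocks. -/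
noncomputable def blockGen (b : L.Box) (x : L.Point) : Sig (Cell (L.toFun x.1)) :=
  ⟨1, fun c => if (⟨x, c⟩ : L.Box) = b then 1 else 0⟩

theorem blockHom_blockGen (b : L.Box) :
    Sig.blockHom (fun x : L.Point => Cell (L.toFun x.1)) (L.blockGen b) = Sig.gen b := by
  refine Sig.ext (Equiv.ext fun _ => rfl) (funext fun j => ?_)
  change (if (⟨j.1, j.2⟩ : L.Box) = b then 1 else 0) = (Pi.single b 1 : L.Box → ℕ) j
  rw [Pi.single_apply]

open Classical in
theorem blockRep_blockGen (b : L.Box) :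
    L.blockRep (L.blockGen b) = ((b.1.1 : ℝ) : ℂ) • LinearMap.id := by
  -- Only the tensor factor containing `b` is affected, with exponent one. Writing the family as an
  -- update of the identity lets the scalar be pulled out.
  have e : (fun x : L.Point => repV (L.toFun x.1) (x.1 : ℝ) (L.blockGen b x)) =
      Function.update (fun _ => LinearMap.id) b.1 (((b.1.1 : ℝ) : ℂ) • LinearMap.id) := by
    funext x
    have h : repV (L.toFun x.1) (x.1 : ℝ) (L.blockGen b x) =
        (((x.1 : ℝ) : ℂ) ^ ∑ c, (L.blockGen b x).mult c) • LinearMap.id := by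
      have h1 : spechtRep (L.toFun x.1) (L.blockGen b x).perm = LinearMap.id :=
        map_one (spechtRep (L.toFun x.1))
      rw [← h1]
      rfl
    rw [h]
    obtain ⟨p, c⟩ := b
    by_cases hx : x = p
    · subst hx
      simp [blockGen]
    · simp [blockGen, hx]
  change PiTensorProduct.map (fun x : L.Point => repV (L.toFun x.1) (x.1 : ℝ) (L.blockGen b x)) = _
  rw [e, PiTensorProduct.map_update_smul, Function.update_eq_self, PiTensorProduct.map_id]
  rfl

/-- The generator `A_b` comes from the block semigroup from which one induces, so it passes through
the tensor sign and acts on `w` by its scalar. -/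
theorem rep_gen_spaceMk (b : L.Box) (w : L.BlockSpace) :
    L.rep (Sig.gen b) (L.spaceMk (1 ⊗ₜ w)) =
      ((b.1.1 : ℝ) : ℂ) • L.spaceMk (1 ⊗ₜ w) := by
  have h : L.spaceMk (((1 : ℂ[Sig L.Box]) * MonoidAlgebra.single (Sig.gen b) 1) ⊗ₜ w) =
      L.spaceMk (1 ⊗ₜ L.blockRep (L.blockGen b) w) := by
    rw [← sub_eq_zero, ← map_sub, ← blockHom_blockGen]
    exact (Submodule.Quotient.mk_eq_zero _).2 (Submodule.subset_span ⟨1, L.blockGen b, w, rfl⟩)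
  rw [blockRep_blockGen, one_mul, LinearMap.smul_apply, LinearMap.id_apply,
    TensorProduct.tmul_smul, map_smul] at h
  rw [← h]
  change L.spaceMk ((MonoidAlgebra.single (Sig.gen b) 1 * 1) ⊗ₜ w) = _
  rw [mul_one]

/-- If `V_Λ ≠ 0`, every point of the support is an eigenvalue of one of the operators `A_b`. -/
theorem exists_eigenvector [Nontrivial L.Space] {x : ℝ} (hx : x ∈ L.support) :
    ∃ (b : L.Box) (v : L.Space), v ≠ 0 ∧ L.rep (Sig.gen b) v = (x : ℂ) • v := by
  obtain ⟨b, rfl⟩ := L.exists_box_of_mem_support hx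
  by_cases h : ∃ w : L.BlockSpace, L.spaceMk ((1 : ℂ[Sig L.Box]) ⊗ₜ w) ≠ 0
  · obtain ⟨w, hw⟩ := h
    exact ⟨b, _, hw, L.rep_gen_spaceMk b w⟩
  · simp only [not_exists, not_not] at h
    exfalso
    -- If every `1 ⊗ w` vanished, the module they generate would be zero.
    have h0 : (LinearMap.id : L.Space →ₗ[ℂ] L.Space) = 0 := ind_ext _ _ fun a w => by
      refine (Submodule.mem_bot ℂ).1 (L.spaceMk_mem a w ⊥ fun t => ?_)
      rw [h, map_zero]
      exact Submodule.zero_mem _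
    obtain ⟨v, hv⟩ := exists_ne (0 : L.Space)
    exact hv (LinearMap.congr_fun h0 v)

end YoungDistribution

theorem tmul_ne_zero {V W : Type*} [AddCommGroup V] [Module ℂ V] [AddCommGroup W] [Module ℂ W]
    {v : V} {w : W} (hv : v ≠ 0) (hw : w ≠ 0) : v ⊗ₜ[ℂ] w ≠ 0 := by
  intro h
  refine hw ((Module.forall_dual_apply_eq_zero_iff ℂ w).1 fun φ => ?_)
  have h1 := congrArg (TensorProduct.rid ℂ V ∘ LinearMap.lTensor V φ) h
  simpa [hv] using h1

end Olshanski

/-! ### Conclusion for the two pairs -/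

open Olshanski in
theorem proposition3 {H : Type*} [NormedAddCommGroup H] [InnerProductSpace ℂ H]
    [CompleteSpace H] :
    (∀ (π : GD →* unitary (H →L[ℂ] H)) (d : ℕ) (L M : YoungDistribution),
      IsAdmissible π → IsIrreducible π → HasDepth π d → 0 < d → CorrespondsD π d L M →
      ∀ ζ ∈ invariants π d, ‖ζ‖ = 1 →
        L.support ⊆ atoms (spectralMeasure (opA π (d + 1)) ζ) ∪ {0} ∧
        M.support ⊆ atoms (spectralMeasure (opA π (d + 1)) ζ) ∪ {0}) ∧
    (∀ (π : GE →* unitary (H →L[ℂ] H)) (d : ℕ) (L : YoungDistribution),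
      IsAdmissible π → IsIrreducible π → HasDepth π d → CorrespondsE π d L →
      ∀ ζ ∈ invariants π d, ‖ζ‖ = 1 →
        L.support ⊆ atoms (spectralMeasure (opA π (d + 1)) ζ) ∪ {0}) := by
  constructor
  · rintro π d L M hadm hirr - - ⟨e, f, U, hinj, hran, -, hL, hM⟩ ζ hζ hζ1
    have hζ0 : ζ ≠ 0 := fun h => by simp [h] at hζ1
    have hlim := isTranspositionLimit_opA_GD π hadm
    -- That `V_Λ` and `V_M` are nonzero is read off from the root, which contains `ζ ≠ 0`; nothing
    -- about Specht modules is required.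
    have hnt : Nontrivial (L.Space ⊗[ℂ] M.Space) := by
      obtain ⟨z, hz⟩ : ζ ∈ LinearMap.range U := hran ▸ hζ
      exact ⟨z, 0, fun h => hζ0 (by rw [← hz, h, map_zero])⟩
    have hntL : Nontrivial L.Space := by
      by_contra h
      rw [not_nontrivial_iff_subsingleton] at h
      exact not_subsingleton (L.Space ⊗[ℂ] M.Space) inferInstance
    have hntM : Nontrivial M.Space := by
      by_contra h
      rw [not_nontrivial_iff_subsingleton] at h
      exact not_subsingleton (L.Space ⊗[ℂ] M.Space) inferInstance
    constructor
    · intro x hx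
      by_cases hx0 : x = 0
      · exact Or.inr hx0
      obtain ⟨b, v, hv, hbv⟩ := L.exists_eigenvector hx
      obtain ⟨m, hm⟩ := exists_ne (0 : M.Space)
      refine Or.inl (mem_atoms_of_eigenvector le_rfl GD_le_GE hlim hirr (i := e b) ?_
        (Or.inl fun j hj => swap_mem_GD ?_) hx0 (v := U (v ⊗ₜ m)) ?_ ?_ hζ0 hζ)
      · have := (e b).2.1
        omega
      · have := (e b).2.1
        omega
      · rw [Ne, map_eq_zero_iff U hinj]
        exact tmul_ne_zero hv hm
      · rw [hL, TensorProduct.map_tmul, hbv, LinearMap.id_apply, ← TensorProduct.smul_tmul',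
          map_smul]
    · intro x hx
      by_cases hx0 : x = 0
      · exact Or.inr hx0
      obtain ⟨b, v, hv, hbv⟩ := M.exists_eigenvector hx
      obtain ⟨m, hm⟩ := exists_ne (0 : L.Space)
      refine Or.inl (mem_atoms_of_eigenvector le_rfl GD_le_GE hlim hirr (i := f b) ?_
        (Or.inr fun j hj => swap_mem_GD ?_) hx0 (v := U (m ⊗ₜ v)) ?_ ?_ hζ0 hζ)
      · have := (f b).2.2
        omega
      · have := (f b).2.2
        omega
      · rw [Ne, map_eq_zero_iff U hinj]
        exact tmul_ne_zero hm hv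
      · rw [hM, TensorProduct.map_tmul, hbv, LinearMap.id_apply, TensorProduct.tmul_smul,
          map_smul]
  · rintro π d L hadm hirr - ⟨e, U, hinj, hran, -, hL⟩ ζ hζ hζ1 x hx
    by_cases hx0 : x = 0
    · exact Or.inr hx0
    have hζ0 : ζ ≠ 0 := fun h => by simp [h] at hζ1
    have hnt : Nontrivial L.Space := by
      obtain ⟨z, hz⟩ : ζ ∈ LinearMap.range U := hran ▸ hζ
      exact ⟨z, 0, fun h => hζ0 (by rw [← hz, h, map_zero])⟩
    obtain ⟨b, v, hv, hbv⟩ := L.exists_eigenvector hx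
    have hb : (e b : ℤ) ≠ 0 := fun h => by simpa [h] using (e b).2.1
    -- In `G^E` a letter of either sign may be exchanged with every positive letter, so the positive
    -- alternative always applies.
    refine Or.inl (mem_atoms_of_eigenvector GD_le_GE le_rfl
      (isTranspositionLimit_opA_GE π hadm) hirr hb
      (Or.inl fun j hj => swap_mem_GE hb (by omega)) hx0 (v := U v) ?_ ?_ hζ0 hζ)
    · rwa [Ne, map_eq_zero_iff U hinj]
    · rw [hL, hbv, map_smul]
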